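/- \textbf{Definitions.} A scattered context grammar is a quadruple $G=(N,T,P,S)$, where $N$ and $T$ are disjoint finite alphabets of nonterminals and terminals, $S\in N$ is the start symbol, and $P$ is a finite set of productions of the form $(A_1,\dots,A_n)\to(x_1,\dots,x_n)$ with $n\ge 1$, $A_i\in N$ and $x_i\in(N\cup T)^*$ for $i=1,\dots,n$ (the words $x_i$ may be empty, that is, erasing productions are allowed). For $u,v\in(N\cup T)^*$ write $u\Rightarrow v$ if there are a production $(A_1,\dots,A_n)\to(x_1,\dots,x_n)$ in $P$ and words $u_1,\dots,u_{n+1}\in(N\cup T)^*$ with $u=u_1A_1u_2A_2\cdots u_nA_nu_{n+1}$ and $v=u_1x_1u_2x_2\cdots u_nx_nu_{n+1}$; such a derivation step rewrites $n$ nonterminals simultaneously. The language generated by $G$ is $L(G)=\{w\in T^*: S\Rightarrow^* w\}$, where $\Rightarrow^*$ is the reflexive and transitive closure of $\Rightarrow$. \textbf{Theorem.} Let $T$ be a finite alphabet and let $L\subseteq T^*$ be a recursively enumerable language. Then there is a scattered context grammar $G=(N,T,P,S)$ with exactly three nonterminals such that $L(G)=L$ and every production $(A_1,\dots,A_n)\to(x_1,\dots,x_n)$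 in $P$ satisfies $n\le 9$; consequently, no more than nine nonterminals are simultaneously rewritten during any derivation step of $G$. -/

import Mathlib

/-- A scattered context production `(A₁, …, Aₙ) → (x₁, …, xₙ)`, `n ≥ 1`, over the terminals `T` and
the nonterminals `N`, given as the nonempty list of the pairs `(Aᵢ, xᵢ)`.
The words `xᵢ` may be empty, so erasing productions are allowed. -/
structure ScatteredProduction (T N : Type*) where
  /-- The list `(A₁, x₁), …, (Aₙ, xₙ)`. -/
  components : List (N × List (Symbol T N))
  components_ne_nil : components ≠ []

namespace ScatteredProduction

variable {T N : Type*}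

/-- The number `n` of nonterminals that the production `(A₁, …, Aₙ) → (x₁, …, xₙ)` rewrites
simultaneously. -/
def width (p : ScatteredProduction T N) : ℕ := p.components.length

/-- `RewritesList [(A₁, x₁), …, (Aₙ, xₙ)] u v` says that
`u = u₁ A₁ u₂ A₂ u₃ … uₙ Aₙ uₙ₊₁` and `v = u₁ x₁ u₂ x₂ u₃ … uₙ xₙ uₙ₊₁`
for some words `u₁, …, uₙ₊₁`. -/
inductive RewritesList :
    List (N × List (Symbol T N)) → List (Symbol T N) → List (Symbol T N) → Prop
  | nil (u : List (Symbol T N)) : RewritesList [] u u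
  | cons (u : List (Symbol T N)) (A : N) (x : List (Symbol T N))
      {ps : List (N × List (Symbol T N))} {v w : List (Symbol T N)}
      (h : RewritesList ps v w) :
      RewritesList ((A, x) :: ps) (u ++ [Symbol.nonterminal A] ++ v) (u ++ x ++ w)

/-- One application of the production `p` turns `u` into `v`. -/
def Rewrites (p : ScatteredProduction T N) (u v : List (Symbol T N)) : Prop :=
  RewritesList p.components u v

end ScatteredProduction

/-- A scattered context grammar with terminal alphabet `T` (erasing productions allowed).
Terminals and nonterminals are disjoint because words are lists over `Symbol T NT`. -/
structure ScatteredContextGrammar (T : Type*) where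
  /-- The nonterminals. -/
  NT : Type
  finite_NT : Finite NT
  /-- The start symbol. -/
  start : NT
  /-- The finite set of productions. -/
  productions : Finset (ScatteredProduction T NT)

namespace ScatteredContextGrammar

variable {T : Type*}

/-- The relation `u ⇒ v`. -/
def Produces (G : ScatteredContextGrammar T) (u v : List (Symbol T G.NT)) : Prop :=
  ∃ p ∈ G.productions, p.Rewrites u v

/-- The relation `u ⇒* v`. -/
def Derives (G : ScatteredContextGrammar T) :
    List (Symbol T G.NT) → List (Symbol T G.NT) → Prop :=
  Relation.ReflTransGen G.Produces

/-- The generated language `{w ∈ T* : S ⇒* w}`. -/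
def language (G : ScatteredContextGrammar T) : Language T :=
  {w : List T | G.Derives [Symbol.nonterminal G.start] (w.map Symbol.terminal)}

end ScatteredContextGrammar

/-! The language is expressed by a Post correspondence problem with output: `w = out(s)` for an
index sequence `s` with `g(s)0 = v₀h(s)`. Such a problem is solved by a grammar whose nonterminals
are a separator $, which is also the start symbol, and the bits 0 and 1.

Write D for `doubled`. The sentential forms are P$U$V$0, where P is the output so far. An index
production appends `out i` to P and D(`g i`) to U, and prepends the reversal of D(`h i`) to V. A
cancelling production moves the outer separators inwards over a doubled bit at the left end of U and
its mirror image at the right end of V. The last production erases $$10$0, where 10 is the reversal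
of D(0). These productions have widths 3, 7 and 6, and the start production has width 1.

Two kinds of misuse are excluded. All productions but the start production rewrite three separators,
so in a form with three separators each of these has a forced position; a bit skipped while
cancelling leaves the zone between the outer separators and can never be erased in full. The start
production lowers by 1 a weight that the others preserve; since terminal words have weight 0, it is
used only once.

Correspondence problems encode semi-Thue rewriting to the empty word, and semi-Thue systems guess an
input and simulate a Turing machine on it. A semidecision procedure for L, viewed as a partial
recursive function of a coded word, yields such a machine. -/

namespace ScatteredContextGrammar

open ScatteredProduction

/-! ### Words over a separator and two bits, and where productions apply. -/

section TwoLetterEncoding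

variable {T : Type*}

/-- Words over three nonterminals: a separator and two bits. -/
abbrev SepWord (T : Type*) := List (Symbol T (Option Bool))

/-- The separator. -/
abbrev sep : Symbol T (Option Bool) := Symbol.nonterminal none

/-- A bit as a nonterminal. -/
abbrev bit (b : Bool) : Symbol T (Option Bool) := Symbol.nonterminal (some b)

/-- Recognizes the separator. -/
def isSep : Symbol T (Option Bool) → Bool
  | Symbol.nonterminal none => true
  | _ => false

@[simp] lemma isSep_sep : isSep (sep : Symbol T (Option Bool)) = true := rfl

@[simp] lemma isSep_bit (b : Bool) : isSep (bit b : Symbol T (Option Bool)) = false := rfl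

@[simp] lemma isSep_terminal (t : T) : isSep (Symbol.terminal t) = false := rfl

/-- The number of separators of a word. -/
def sepCount (u : SepWord T) : ℕ := u.countP isSep

@[simp] lemma sepCount_nil : sepCount ([] : SepWord T) = 0 := rfl

@[simp] lemma sepCount_cons (a : Symbol T (Option Bool)) (u : SepWord T) :
    sepCount (a :: u) = sepCount u + if isSep a then 1 else 0 := List.countP_cons

@[simp] lemma sepCount_append (u v : SepWord T) : sepCount (u ++ v) = sepCount u + sepCount v :=
  List.countP_append

@[simp] lemma sepCount_map_bit (l : List Bool) : sepCount (T := T) (l.map bit) = 0 := by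
  induction l with
  | nil => rfl
  | cons b l ih => simpa using ih

@[simp] lemma sepCount_map_terminal (l : List T) : sepCount (l.map Symbol.terminal) = 0 := by
  induction l with
  | nil => rfl
  | cons b l ih => simpa using ih

/-- The number of separators that a production rewrites. -/
def sepWidth (ps : List (Option Bool × SepWord T)) : ℕ := ps.countP fun p => p.1.isNone

@[simp] lemma sepWidth_nil : sepWidth ([] : List (Option Bool × SepWord T)) = 0 := rfl

@[simp] lemma sepWidth_cons (p : Option Bool × SepWord T) (ps : List (Option Bool × SepWord T)) :
    sepWidth (p :: ps) = sepWidth ps + if p.1.isNone then 1 else 0 := List.countP_cons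

lemma sepWidth_le_sepCount {ps : List (Option Bool × SepWord T)} {u v : SepWord T}
    (h : RewritesList ps u v) : sepWidth ps ≤ sepCount u := by
  induction h with
  | nil u => simp
  | cons u A x h ih =>
    rcases A with _ | b <;> simp [isSep] <;> omega

/-- Pigeonhole: if the first component used a separator inside `R`, fewer than `sepWidth ps`
separators would remain for the later components. -/
lemma rewritesList_sep_inv {ps : List (Option Bool × SepWord T)} {P R v x : SepWord T}
    (h : RewritesList ((none, x) :: ps) (P ++ sep :: R) v)
    (hP : sepCount P = 0) (hR : sepCount R ≤ sepWidth ps) :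
    ∃ w, RewritesList ps R w ∧ v = P ++ x ++ w := by
  generalize hu : P ++ sep :: R = u at h
  cases h with
  | cons u₁ A x h =>
    rename_i v' w'
    have hle := sepWidth_le_sepCount h
    simp only [List.append_assoc, List.singleton_append] at hu
    rcases List.append_eq_append_iff.1 hu with ⟨t, h₁, h₂⟩ | ⟨t, h₁, h₂⟩
    · rcases t with _ | ⟨c, t⟩
      · simp at h₁ h₂
        subst h₁ h₂
        exact ⟨_, h, rfl⟩
      · simp at h₂
        obtain ⟨rfl, rfl⟩ := h₂
        simp at hR hle
        omega
    · rcases t with _ | ⟨c, t⟩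
      · simp at h₁ h₂
        subst h₁ h₂
        exact ⟨_, h, rfl⟩
      · simp at h₂
        obtain ⟨rfl, rfl⟩ := h₂
        subst h₁
        simp at hP

/-- A bit chosen inside `R` would jump over the separator at the head of `R`, leaving too few for
the remaining components. -/
lemma rewritesList_bit_inv {ps : List (Option Bool × SepWord T)} {U : List Bool}
    {R v x : SepWord T} {b : Bool}
    (h : RewritesList ((some b, x) :: ps) (U.map bit ++ R) v)
    (hR : sepCount R ≤ sepWidth ps) (hd : R = [] ∨ ∃ R', R = sep :: R') :
    ∃ U₁ U₂ w, U = U₁ ++ b :: U₂ ∧ RewritesList ps (U₂.map bit ++ R) w ∧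
      v = U₁.map bit ++ x ++ w := by
  generalize hu : U.map bit ++ R = u at h
  cases h with
  | cons u₁ A x h =>
    rename_i v' w'
    have hle := sepWidth_le_sepCount h
    simp only [List.append_assoc, List.singleton_append] at hu
    have key : ∀ t, u₁ = U.map bit ++ t → R = t ++ Symbol.nonterminal (some b) :: v' → False := by
      intro t h₁ h₂
      rcases hd with rfl | ⟨R', rfl⟩
      · simp at h₂
      · rcases t with _ | ⟨c, t⟩
        · simp at h₂
        · simp at h₂
          obtain ⟨rfl, rfl⟩ := h₂
          simp at hR hle
          omega
    rcases List.append_eq_append_iff.1 hu with ⟨t, h₁, h₂⟩ | ⟨t, h₁, h₂⟩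
    · exact (key t h₁ h₂).elim
    · rcases t with _ | ⟨c, t⟩
      · simp at h₁ h₂
        exact (key [] (by simp [h₁]) (by simp [h₂])).elim
      · simp at h₂
        obtain ⟨rfl, rfl⟩ := h₂
        obtain ⟨U₁, U', rfl, rfl, h₃⟩ := List.map_eq_append_iff.1 h₁
        obtain ⟨b', U₂, rfl, h₄, rfl⟩ := List.map_eq_cons_iff.1 h₃
        simp at h₄
        subst h₄
        exact ⟨_, _, _, rfl, h, rfl⟩

/-! ### Complement doubling and a weight invariant. -/

/-- Every bit followed by its complement. -/
def doubled (l : List Bool) : List Bool := l.flatMap fun b => [b, !b]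

@[simp] lemma doubled_nil : doubled [] = [] := rfl

@[simp] lemma doubled_cons (b : Bool) (l : List Bool) : doubled (b :: l) = b :: (!b) :: doubled l :=
  rfl

@[simp] lemma doubled_append (l m : List Bool) : doubled (l ++ m) = doubled l ++ doubled m := by
  simp [doubled]

lemma doubled_injective : Function.Injective doubled := by
  intro l
  induction l with
  | nil => intro m h; cases m <;> simp at h ⊢
  | cons b l ih =>
    intro m h
    cases m with
    | nil => simp at h
    | cons c m => simp at h; simp [h.1, ih h.2]

/-- A weight that no production below changes, except for the one of the start symbol. -/
def weight : Symbol T (Option Bool) → ℤ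
  | Symbol.terminal _ => 0
  | Symbol.nonterminal none => 1
  | Symbol.nonterminal (some false) => -3
  | Symbol.nonterminal (some true) => 3

/-- The total weight of a word. -/
def totalWeight (u : SepWord T) : ℤ := (u.map weight).sum

@[simp] lemma totalWeight_nil : totalWeight ([] : SepWord T) = 0 := rfl

@[simp] lemma totalWeight_cons (a : Symbol T (Option Bool)) (u : SepWord T) :
    totalWeight (a :: u) = weight a + totalWeight u := by simp [totalWeight]

@[simp] lemma totalWeight_append (u v : SepWord T) :
    totalWeight (u ++ v) = totalWeight u + totalWeight v := by simp [totalWeight]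

@[simp] lemma totalWeight_reverse (u : SepWord T) : totalWeight u.reverse = totalWeight u := by
  simp [totalWeight, List.sum_reverse]

@[simp] lemma totalWeight_map_terminal (w : List T) : totalWeight (w.map Symbol.terminal) = 0 := by
  induction w with
  | nil => rfl
  | cons t w ih => simpa [weight] using ih

@[simp] lemma totalWeight_doubled (l : List Bool) : totalWeight (T := T) ((doubled l).map bit) = 0 := by
  induction l with
  | nil => rfl
  | cons b l ih => cases b <;> simpa [weight] using ih

/-- The change of weight made by a production. -/
def weightChange (ps : List (Option Bool × SepWord T)) : ℤ :=
  (ps.map fun p => totalWeight p.2 - weight (T := T) (Symbol.nonterminal p.1)).sum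

@[simp] lemma weightChange_nil : weightChange ([] : List (Option Bool × SepWord T)) = 0 := rfl

@[simp] lemma weightChange_cons (p : Option Bool × SepWord T)
    (ps : List (Option Bool × SepWord T)) : weightChange (p :: ps) =
      totalWeight p.2 - weight (T := T) (Symbol.nonterminal p.1) + weightChange ps := by
  simp [weightChange]

lemma totalWeight_of_rewritesList {ps : List (Option Bool × SepWord T)} {u v : SepWord T}
    (h : RewritesList ps u v) : totalWeight v = totalWeight u + weightChange ps := by
  induction h with
  | nil u => simp
  | cons u A x h ih =>
    simp [ih]
    ring

/-! ### The grammar of a correspondence problem with output. -/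

variable {I : Type*} (g h : I → List Bool) (out : I → List T) (v₀ : List Bool)

/-- The productions of the grammar of a Post correspondence problem with output. -/
def pcpRule : (I ⊕ Bool) ⊕ Bool → List (Option Bool × SepWord T)
  | .inl (.inl i) =>
    [(none, (out i).map Symbol.terminal ++ [sep]),
      (none, (doubled (g i)).map bit ++ sep :: (doubled (h i)).reverse.map bit), (none, [sep])]
  | .inl (.inr b) =>
    [(none, []), (some b, []), (some !b, [sep]), (none, [sep]), (some !b, [sep]), (some b, []),
      (none, [])]
  | .inr true => [(none, sep :: sep :: (doubled v₀).reverse.map bit ++ [sep, bit false])]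
  | .inr false =>
    [(none, []), (none, []), (some true, []), (some false, []), (none, []), (some false, [])]

/-- The grammar of a Post correspondence problem with output. -/
noncomputable def pcpGrammar [Finite I] : ScatteredContextGrammar T where
  NT := Option Bool
  finite_NT := inferInstance
  start := none
  productions := (Set.finite_range fun r => (⟨pcpRule g h out v₀ r, by
    rcases r with (i | b) | (_ | _) <;> simp [pcpRule]⟩ :
      ScatteredProduction T (Option Bool))).toFinset

/-- The one-step relation of `pcpGrammar`. -/
def PcpStep (u v : SepWord T) : Prop := ∃ r, RewritesList (pcpRule g h out v₀ r) u v

lemma pcpGrammar_derives [Finite I] (u v : SepWord T) :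
    (pcpGrammar g h out v₀).Derives u v ↔ Relation.ReflTransGen (PcpStep g h out v₀) u v := by
  have : (pcpGrammar g h out v₀).Produces = PcpStep g h out v₀ := by
    ext u v
    constructor
    · rintro ⟨p, hp, hr⟩
      obtain ⟨r, rfl⟩ := (Set.Finite.mem_toFinset _).1 hp
      exact ⟨r, hr⟩
    · rintro ⟨r, hr⟩
      exact ⟨⟨_, _⟩, (Set.Finite.mem_toFinset _).2 ⟨r, rfl⟩, hr⟩
  rw [Derives, this]
  rfl

lemma pcpGrammar_width [Finite I] :
    ∀ p ∈ (pcpGrammar g h out v₀).productions, p.width ≤ 9 := by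
  intro p hp
  obtain ⟨r, rfl⟩ := (Set.Finite.mem_toFinset _).1 hp
  rcases r with (i | b) | (_ | _) <;> exact Nat.le_of_ble_eq_true rfl

/-- The intermediate sentential forms. -/
abbrev sepForm (P : SepWord T) (U V X : List Bool) : SepWord T :=
  P ++ sep :: (U.map bit ++ sep :: (V.map bit ++ sep :: X.map bit))

lemma one_le_sepWidth_pcpRule (r) : 1 ≤ sepWidth (pcpRule g h out v₀ r) := by
  rcases r with (i | b) | (_ | _) <;> simp [pcpRule]

lemma weightChange_pcpRule_start : weightChange (pcpRule g h out v₀ (.inr true)) = -1 := by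
  simp [pcpRule, weight]

lemma weightChange_pcpRule {r} (hr : r ≠ .inr true) : weightChange (pcpRule g h out v₀ r) = 0 := by
  rcases r with (i | b) | (_ | _)
  · simp [pcpRule, weight]
  · cases b <;> simp [pcpRule, weight]
  · simp [pcpRule, weight]
  · exact (hr rfl).elim

variable {g h out v₀}

/-- Productions never raise the weight, and terminal words have weight 0. The three separators of a
sentential form balance the final 0 of weight -3, and doubled bits weigh nothing; so after the first
step the weight is 0 and the start production would make it negative. -/
lemma totalWeight_nonneg_of_derives {u : SepWord T} {w : List T}
    (H : Relation.ReflTransGen (PcpStep g h out v₀) u (w.map Symbol.terminal)) :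
    0 ≤ totalWeight u := by
  induction H using Relation.ReflTransGen.head_induction_on with
  | refl => rw [totalWeight_map_terminal]
  | head hs _ ih =>
    obtain ⟨r, hr⟩ := hs
    have := totalWeight_of_rewritesList hr
    by_cases hst : r = .inr true
    · subst hst
      rw [weightChange_pcpRule_start] at this
      omega
    · rw [weightChange_pcpRule _ _ _ _ hst] at this
      omega

lemma eq_of_derives_of_sepCount {u v : SepWord T}
    (H : Relation.ReflTransGen (PcpStep g h out v₀) u v) (hu : sepCount u = 0) : u = v := by
  rcases Relation.ReflTransGen.cases_head H with rfl | ⟨_, ⟨r, hr⟩, _⟩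
  · rfl
  · have := sepWidth_le_sepCount hr
    have := one_le_sepWidth_pcpRule g h out v₀ r
    omega

lemma eq_nil_of_map_bit_subset {l : List Bool} {w : List T}
    (hl : ∀ b ∈ l, (bit b : Symbol T (Option Bool)) ∈ w.map Symbol.terminal) : l = [] := by
  rw [List.eq_nil_iff_forall_not_mem]
  intro b hb
  simpa using hl b hb

/-- Induction from the end of the derivation, so that the defects `X ≠ []` and nonterminals in `P`
are already excluded for the next form. The concluding equation is what U and V still need in order
to cancel; `X` is kept arbitrary because a wrong cancellation enlarges it. -/
lemma exists_of_sepForm_derives {w : List T} {u : SepWord T}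
    (H : Relation.ReflTransGen (PcpStep g h out v₀) u (w.map Symbol.terminal)) :
    ∀ P U V X, u = sepForm P U V (X ++ [false]) → sepCount P = 0 → totalWeight u = 0 →
      ∃ (s : List I) (p : List T), P = p.map Symbol.terminal ∧ X = [] ∧ w = p ++ s.flatMap out ∧
        U ++ doubled (s.flatMap g ++ [false]) = V.reverse ++ doubled (s.flatMap h) := by
  induction H using Relation.ReflTransGen.head_induction_on with
  | refl =>
    intro P U V X hu _ _
    have := congrArg sepCount hu
    simp at this
  | @head u u' hs hd ih =>
    rintro P U V X rfl hP hW
    obtain ⟨r, hr⟩ := hs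
    have hW' := totalWeight_of_rewritesList hr
    by_cases hst : r = .inr true
    · subst hst
      rw [weightChange_pcpRule_start, hW] at hW'
      have := totalWeight_nonneg_of_derives hd
      omega
    rw [weightChange_pcpRule _ _ _ _ hst, hW, add_zero] at hW'
    rcases r with (i | b) | (_ | _)
    · obtain ⟨w₁, hr₁, rfl⟩ := rewritesList_sep_inv hr hP (by simp)
      obtain ⟨w₂, hr₂, rfl⟩ := rewritesList_sep_inv hr₁ (by simp) (by simp)
      obtain ⟨w₃, hr₃, rfl⟩ := rewritesList_sep_inv hr₂ (by simp) (by simp)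
      cases hr₃
      obtain ⟨s, p, hp, rfl, rfl, he⟩ := ih (P ++ (out i).map Symbol.terminal) (U ++ doubled (g i))
        ((doubled (h i)).reverse ++ V) X (by simp) (by simpa using hP) hW'
      obtain ⟨p₁, p₂, rfl, rfl, hp₂⟩ := List.map_eq_append_iff.1 hp.symm
      have : p₂ = out i :=
        List.map_injective_iff.2 (fun a b hab => by simpa using hab) hp₂
      subst this
      refine ⟨i :: s, p₁, rfl, rfl, by simp, ?_⟩
      simpa using he
    · obtain ⟨w₁, hr₁, rfl⟩ := rewritesList_sep_inv hr hP (by simp)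
      obtain ⟨U₁, U', w₂, rfl, hr₂, rfl⟩ := rewritesList_bit_inv hr₁ (by simp) (.inr ⟨_, rfl⟩)
      obtain ⟨U₂, U₃, w₃, rfl, hr₃, rfl⟩ := rewritesList_bit_inv hr₂ (by simp) (.inr ⟨_, rfl⟩)
      obtain ⟨w₄, hr₄, rfl⟩ := rewritesList_sep_inv hr₃ (by simp) (by simp)
      obtain ⟨V₁, V', w₅, rfl, hr₅, rfl⟩ := rewritesList_bit_inv hr₄ (by simp) (.inr ⟨_, rfl⟩)
      obtain ⟨V₂, V₃, w₆, rfl, hr₆, rfl⟩ := rewritesList_bit_inv hr₅ (by simp) (.inr ⟨_, rfl⟩)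
      obtain ⟨w₇, hr₇, rfl⟩ := rewritesList_sep_inv hr₆ (by simp) (by simp)
      cases hr₇
      obtain ⟨s, p, hp, hX, rfl, he⟩ := ih (P ++ (U₁ ++ U₂).map bit) U₃ V₁ (V₂ ++ V₃ ++ X)
        (by simp) (by simpa using hP) hW'
      -- The bits skipped in U now stand left of all separators, in a prefix that must be terminal;
      -- those skipped in V form part of the new X, which is empty by `hX`.
      have hU : U₁ ++ U₂ = [] := eq_nil_of_map_bit_subset (w := p) fun b hb => by
        rw [← hp]; exact List.mem_append_right _ (List.mem_map_of_mem hb)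
      simp only [List.append_eq_nil_iff] at hU hX
      obtain ⟨rfl, rfl⟩ := hU
      obtain ⟨⟨rfl, rfl⟩, rfl⟩ := hX
      exact ⟨s, p, by simpa using hp, rfl, rfl, by simpa using he⟩
    · obtain ⟨w₁, hr₁, rfl⟩ := rewritesList_sep_inv hr hP (by simp)
      obtain ⟨w₂, hr₂, rfl⟩ := rewritesList_sep_inv hr₁ (by simp) (by simp)
      obtain ⟨V₁, V', w₃, rfl, hr₃, rfl⟩ := rewritesList_bit_inv hr₂ (by simp) (.inr ⟨_, rfl⟩)
      obtain ⟨V₂, V₃, w₄, rfl, hr₄, rfl⟩ := rewritesList_bit_inv hr₃ (by simp) (.inr ⟨_, rfl⟩)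
      obtain ⟨w₅, hr₅, rfl⟩ := rewritesList_sep_inv hr₄ (by simp) (by simp)
      rw [← List.append_nil (List.map bit _)] at hr₅
      obtain ⟨X₁, X₂, w₆, hX, hr₆, rfl⟩ := rewritesList_bit_inv hr₅ (by simp) (.inl rfl)
      cases hr₆
      -- No separator is left, so the derivation is over and every surviving bit would have to be
      -- terminal.
      have heq := eq_of_derives_of_sepCount hd (by simpa using hP)
      have hnil : U ++ V₁ ++ V₂ ++ V₃ ++ X₁ ++ X₂ = [] :=
        eq_nil_of_map_bit_subset (w := w) fun b hb => by
          rw [← heq]; simp at hb ⊢; tauto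
      simp only [List.append_eq_nil_iff] at hnil
      obtain ⟨⟨⟨⟨⟨rfl, rfl⟩, rfl⟩, rfl⟩, rfl⟩, rfl⟩ := hnil
      refine ⟨[], w, by simpa using heq, ?_, by simp, by simp⟩
      simpa using congrArg List.length hX
    · exact (hst rfl).elim

lemma rewritesList_cons_of_eq {u v v' w : SepWord T} {A : Option Bool} {x : SepWord T}
    {ps : List (Option Bool × SepWord T)} (u' : SepWord T) (h : RewritesList ps v v')
    (hu : u = u' ++ Symbol.nonterminal A :: v) (hw : w = u' ++ x ++ v') :
    RewritesList ((A, x) :: ps) u w := by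
  subst hu hw
  simpa using RewritesList.cons u' A x h

lemma sepForm_derives_append (s : List I) (p : List T) (U V : List Bool) :
    Relation.ReflTransGen (PcpStep g h out v₀) (sepForm (p.map Symbol.terminal) U V [false])
      (sepForm ((p ++ s.flatMap out).map Symbol.terminal) (U ++ doubled (s.flatMap g))
        ((doubled (s.flatMap h)).reverse ++ V) [false]) := by
  induction s generalizing p U V with
  | nil => simpa using Relation.ReflTransGen.refl
  | cons i s ih =>
    refine Relation.ReflTransGen.head (b := sepForm ((p ++ out i).map Symbol.terminal)
      (U ++ doubled (g i)) ((doubled (h i)).reverse ++ V) [false]) ⟨.inl (.inl i), ?_⟩ ?_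
    · refine rewritesList_cons_of_eq (p.map Symbol.terminal) (rewritesList_cons_of_eq (U.map bit) (rewritesList_cons_of_eq (V.map bit) (.nil _) rfl rfl)
        rfl rfl) rfl ?_
      simp
    · simpa using ih (p ++ out i) (U ++ doubled (g i)) ((doubled (h i)).reverse ++ V)

lemma sepForm_derives_cancel (l : List Bool) (p : List T) (V : List Bool) :
    Relation.ReflTransGen (PcpStep g h out v₀)
      (sepForm (p.map Symbol.terminal) (doubled l) (V ++ (doubled l).reverse) [false])
      (sepForm (p.map Symbol.terminal) [] V [false]) := by
  induction l with
  | nil => simpa using Relation.ReflTransGen.refl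
  | cons b l ih =>
    refine Relation.ReflTransGen.head ⟨.inl (.inr b), ?_⟩ ih
    refine rewritesList_cons_of_eq (p.map Symbol.terminal) (rewritesList_cons_of_eq [] (rewritesList_cons_of_eq [] (rewritesList_cons_of_eq ((doubled l).map bit)
      (rewritesList_cons_of_eq ((V ++ (doubled l).reverse).map bit) (rewritesList_cons_of_eq [] (rewritesList_cons_of_eq [] (.nil [bit false])
      rfl rfl) rfl rfl) rfl rfl) rfl rfl) rfl rfl) rfl rfl) ?_ ?_ <;> simp

variable (g h out v₀)

/-- A single separator admits only the start production, since the others need three. -/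
lemma reflTransGen_pcpStep_iff (w : List T) :
    Relation.ReflTransGen (PcpStep g h out v₀) [sep] (w.map Symbol.terminal) ↔
      ∃ s : List I, w = s.flatMap out ∧ s.flatMap g ++ [false] = v₀ ++ s.flatMap h := by
  have hstart : PcpStep g h out v₀ [sep] (sepForm [] [] (doubled v₀).reverse [false]) :=
    ⟨.inr true, rewritesList_cons_of_eq [] (.nil []) rfl (by simp)⟩
  constructor
  · intro H
    rcases Relation.ReflTransGen.cases_head H with he | ⟨u, ⟨r, hr⟩, hd⟩
    · have := congrArg sepCount he
      simp at this
    · have hle := sepWidth_le_sepCount hr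
      rcases r with (i | b) | (_ | _)
      · simp [pcpRule] at hle
      · simp [pcpRule] at hle
      · simp [pcpRule] at hle
      · obtain ⟨w₁, hr₁, rfl⟩ := rewritesList_sep_inv (P := []) (R := []) hr (by simp) (by simp)
        cases hr₁
        obtain ⟨s, p, hp, -, rfl, he⟩ := exists_of_sepForm_derives hd [] [] (doubled v₀).reverse []
          (by simp) (by simp) (by simp [weight])
        obtain rfl : p = [] := by simpa using hp.symm
        refine ⟨s, by simp, doubled_injective ?_⟩
        simpa using he
  · rintro ⟨s, rfl, he⟩
    refine Relation.ReflTransGen.head hstart ((sepForm_derives_append s [] [] _).trans ?_)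
    -- The extra 0 in the correspondence leaves exactly the block 10 that the last production
    -- erases.
    have hV : (doubled (s.flatMap h)).reverse ++ (doubled v₀).reverse =
        [true, false] ++ (doubled (s.flatMap g)).reverse := by
      rw [← List.reverse_append, ← doubled_append, ← he]
      simp
    rw [hV]
    simp only [List.nil_append]
    refine (sepForm_derives_cancel _ _ _).trans (Relation.ReflTransGen.single ⟨.inr false, ?_⟩)
    refine rewritesList_cons_of_eq ((s.flatMap out).map Symbol.terminal) (rewritesList_cons_of_eq [] (rewritesList_cons_of_eq [] (rewritesList_cons_of_eq [] (rewritesList_cons_of_eq []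
      (rewritesList_cons_of_eq [] (.nil []) rfl rfl) rfl rfl) rfl rfl) rfl rfl) rfl rfl) ?_ ?_ <;> simp

theorem mem_pcpGrammar_language [Finite I] (w : List T) :
    w ∈ (pcpGrammar g h out v₀).language ↔
      ∃ s : List I, w = s.flatMap out ∧ s.flatMap g ++ [false] = v₀ ++ s.flatMap h :=
  (pcpGrammar_derives g h out v₀ _ _).trans (reflTransGen_pcpStep_iff g h out v₀ w)

end TwoLetterEncoding

end ScatteredContextGrammar

/-! ### Semi-Thue rewriting as a correspondence problem. -/

section SemiThue

variable {T α R : Type*} (lhs rhs : R → List α) (out : R → List T)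

/-- `SemiThueAccepts lhs rhs out u w` says that the rules `lhs r → rhs r` rewrite `u` to the empty
word in some way such that the words `out r` for the rules used, in order, spell `w`. -/
inductive SemiThueAccepts : List α → List T → Prop
  | nil : SemiThueAccepts [] []
  | step (y : List α) (r : R) (x : List α) {w : List T}
      (h : SemiThueAccepts (y ++ rhs r ++ x) w) : SemiThueAccepts (y ++ lhs r ++ x) (out r ++ w)

/-- The left words of the correspondence problem of a semi-Thue system; `none` ends a line. -/
def semiThueLeft : Option α ⊕ R → List (Option α)
  | .inl a => [a]
  | .inr r => (lhs r).map some

/-- The output of the correspondence problem of a semi-Thue system. -/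
def semiThueOut : Option α ⊕ R → List T
  | .inl _ => []
  | .inr r => out r

lemma exists_of_map_some_append_eq {L x : List α} {A B : List (Option α)}
    (h : L.map some ++ A = x.map some ++ none :: B) :
    ∃ x', x = L ++ x' ∧ A = x'.map some ++ none :: B := by
  induction L generalizing x with
  | nil => exact ⟨x, rfl, h⟩
  | cons a L ih =>
    cases x with
    | nil => simp at h
    | cons b x =>
      simp at h
      obtain ⟨x', rfl, h'⟩ := ih h.2
      exact ⟨x', by simp [h.1], h'⟩

variable {lhs rhs out}

/-- The right side runs one line ahead of the left: `x` is the unread rest of the current line and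
`y` the part of the next line already written. Copying a letter or ending a line preserves the word
`y ++ x`, and a rule letter rewrites it. The final `none` can match only when both parts are empty.
-/
lemma semiThueAccepts_of_correspondence (s : List (Option α ⊕ R)) (x y : List α)
    (h : s.flatMap (semiThueLeft lhs) ++ [none] =
      x.map some ++ none :: (y.map some ++ s.flatMap (semiThueLeft rhs))) :
    SemiThueAccepts lhs rhs out (y ++ x) (s.flatMap (semiThueOut out)) := by
  induction s generalizing x y with
  | nil =>
    cases x with
    | nil =>
      cases y with
      | nil => exact .nil
      | cons b y => simp at h
    | cons b x => simp at h
  | cons i s ih =>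
    simp only [List.flatMap_cons, List.append_assoc] at h ⊢
    rcases i with (_ | a) | r
    · cases x with
      | nil =>
        simp only [semiThueLeft, List.map_nil, List.nil_append, List.singleton_append,
          List.cons.injEq, true_and] at h
        simpa [semiThueOut] using ih y [] (by simpa using h)
      | cons b x => simp [semiThueLeft] at h
    · cases x with
      | nil => simp [semiThueLeft] at h
      | cons b x =>
        simp only [semiThueLeft, List.map_cons, List.cons_append,
          List.cons.injEq, Option.some.injEq] at h
        obtain ⟨rfl, h⟩ := h
        simpa [semiThueOut] using ih x (y ++ [a]) (by simpa using h)
    · obtain ⟨x', rfl, h'⟩ := exists_of_map_some_append_eq h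
      have := ih x' (y ++ rhs r) (by simpa [semiThueLeft] using h')
      simpa [semiThueOut] using SemiThueAccepts.step y r x' this

lemma flatMap_copy (rl : R → List α) (y : List α) :
    (y.map fun a => (Sum.inl (some a) : Option α ⊕ R)).flatMap (semiThueLeft rl) = y.map some := by
  induction y with
  | nil => rfl
  | cons a y ih => simp [semiThueLeft, ih]

lemma flatMap_copy_out (y : List α) :
    (y.map fun a => (Sum.inl (some a) : Option α ⊕ R)).flatMap (semiThueOut out) = [] := by
  induction y with
  | nil => rfl
  | cons a y ih => simp [semiThueOut]

lemma correspondence_of_semiThueAccepts {u : List α} {w : List T}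
    (h : SemiThueAccepts lhs rhs out u w) :
    ∃ s : List (Option α ⊕ R), w = s.flatMap (semiThueOut out) ∧
      s.flatMap (semiThueLeft lhs) ++ [none] =
        (u.map some ++ [none]) ++ s.flatMap (semiThueLeft rhs) := by
  induction h with
  | nil => exact ⟨[], by simp⟩
  | step y r x h ih =>
    obtain ⟨s, rfl, hs⟩ := ih
    -- One rewriting step is one full line: copy `y`, apply `r`, copy `x`, end the line.
    refine ⟨(y.map fun a => .inl (some a)) ++ [.inr r] ++ (x.map fun a => .inl (some a)) ++
      [.inl none] ++ s, ?_, ?_⟩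
    · simp only [List.flatMap_append, flatMap_copy_out]
      simp [semiThueOut]
    · rw [List.flatMap_append, List.append_assoc _ _ [none], hs]
      simp only [List.flatMap_append, flatMap_copy]
      simp [semiThueLeft]

/-- A unary prefix code. -/
def unaryCode (n : ℕ) : List Bool := List.replicate n true ++ [false]

lemma unaryCode_append_inj {m n : ℕ} {x y : List Bool}
    (h : unaryCode m ++ x = unaryCode n ++ y) : m = n ∧ x = y := by
  induction m generalizing n with
  | zero => cases n <;> simp_all [unaryCode, List.replicate_succ]
  | succ m ih =>
    cases n with
    | zero => simp [unaryCode, List.replicate_succ] at h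
    | succ n =>
      obtain ⟨rfl, rfl⟩ := ih (n := n) (by simpa [unaryCode, List.replicate_succ] using h)
      exact ⟨rfl, rfl⟩

lemma flatMap_unaryCode_injective {β : Type*} {k : β → ℕ} (hk : Function.Injective k) :
    Function.Injective fun l : List β => l.flatMap fun a => unaryCode (k a) := by
  intro l
  induction l with
  | nil => intro m h; cases m <;> simp [unaryCode] at h ⊢
  | cons a l ih =>
    intro m h
    cases m with
    | nil => simp [unaryCode] at h
    | cons b m =>
      obtain ⟨h₁, h₂⟩ := unaryCode_append_inj (by simpa using h)
      rw [hk h₁, ih h₂]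

variable (lhs rhs out)

theorem exists_scatteredContextGrammar_of_semiThue [Finite α] [Finite R] (u : List α) :
    ∃ G : ScatteredContextGrammar T, Nat.card G.NT = 3 ∧ (∀ p ∈ G.productions, p.width ≤ 9) ∧
      ∀ w, w ∈ G.language ↔ SemiThueAccepts lhs rhs out u w := by
  obtain ⟨k, hk⟩ := Countable.exists_injective_nat α
  -- The line end gets number 0, so that its code is the single bit 0 of the correspondence problem.
  let k' : Option α → ℕ := fun a => a.elim 0 fun a => k a + 1
  have hk' : Function.Injective k' := by
    rintro (_ | a) (_ | b) h <;> simp [k'] at h ⊢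
    exact hk h
  let c : List (Option α) → List Bool := fun l => l.flatMap fun a => unaryCode (k' a)
  have hc : Function.Injective c := flatMap_unaryCode_injective hk'
  have hca : ∀ l m, c (l ++ m) = c l ++ c m := fun l m => List.flatMap_append
  have hcf : ∀ (f : Option α ⊕ R → List (Option α)) (s : List _), s.flatMap (fun i => c (f i)) =
      c (s.flatMap f) := fun f s => List.flatMap_assoc.symm
  have hn : c [none] = [false] := rfl
  refine ⟨ScatteredContextGrammar.pcpGrammar (fun i => c (semiThueLeft lhs i))
    (fun i => c (semiThueLeft rhs i)) (semiThueOut out) (c (u.map some ++ [none])), ?_,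
    ScatteredContextGrammar.pcpGrammar_width _ _ _ _, fun w => ?_⟩
  · change Nat.card (Option Bool) = 3
    simp
  · rw [ScatteredContextGrammar.mem_pcpGrammar_language]
    simp only [hcf, ← hn, ← hca, hc.eq_iff]
    constructor
    · rintro ⟨s, rfl, h⟩
      simpa using semiThueAccepts_of_correspondence s u [] (by simpa using h)
    · exact correspondence_of_semiThueAccepts

end SemiThue

/-! ### Turing machines as semi-Thue systems. -/

section TuringMachineRules

open Turing StateTransition

/-- The letters of the configurations of a Turing machine, written as words. -/
inductive TapeLetter (Q Γ : Type*)
  | state (q : Q)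
  | cell (a : Γ)
  | leftEnd
  | rightEnd
  | halted
  | generator

/-- The rules for generating an input word and running a Turing machine on it. -/
inductive TapeRule (T Q Γ : Type*)
  | emit (t : T)
  | start
  | padLeft
  | padRight
  | trans (q : Q) (a b : Γ)
  | absorbLeft (x : TapeLetter Q Γ)
  | absorbRight (x : TapeLetter Q Γ)
  | vanish

instance {Q Γ : Type*} [Finite Q] [Finite Γ] : Finite (TapeLetter Q Γ) :=
  Finite.of_surjective (α := Q ⊕ Γ ⊕ Fin 4)
    (fun
      | .inl q => .state q
      | .inr (.inl a) => .cell a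
      | .inr (.inr 0) => .leftEnd
      | .inr (.inr 1) => .rightEnd
      | .inr (.inr 2) => .halted
      | .inr (.inr 3) => .generator)
    (by
      rintro (q | a | _ | _ | _ | _)
      exacts [⟨.inl q, rfl⟩, ⟨.inr (.inl a), rfl⟩, ⟨.inr (.inr 0), rfl⟩, ⟨.inr (.inr 1), rfl⟩,
        ⟨.inr (.inr 2), rfl⟩, ⟨.inr (.inr 3), rfl⟩])

instance {T Q Γ : Type*} [Finite T] [Finite Q] [Finite Γ] : Finite (TapeRule T Q Γ) :=
  Finite.of_surjective
    (α := T ⊕ (Q × Γ × Γ) ⊕ TapeLetter Q Γ ⊕ TapeLetter Q Γ ⊕ Fin 4)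
    (fun
      | .inl t => .emit t
      | .inr (.inl (q, a, b)) => .trans q a b
      | .inr (.inr (.inl x)) => .absorbLeft x
      | .inr (.inr (.inr (.inl x))) => .absorbRight x
      | .inr (.inr (.inr (.inr 0))) => .start
      | .inr (.inr (.inr (.inr 1))) => .padLeft
      | .inr (.inr (.inr (.inr 2))) => .padRight
      | .inr (.inr (.inr (.inr 3))) => .vanish)
    (by
      rintro (t | _ | _ | _ | ⟨q, a, b⟩ | x | x | _)
      exacts [⟨.inl t, rfl⟩, ⟨.inr (.inr (.inr (.inr 0))), rfl⟩,
        ⟨.inr (.inr (.inr (.inr 1))), rfl⟩, ⟨.inr (.inr (.inr (.inr 2))), rfl⟩,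
        ⟨.inr (.inl (q, a, b)), rfl⟩, ⟨.inr (.inr (.inl x)), rfl⟩,
        ⟨.inr (.inr (.inr (.inl x))), rfl⟩, ⟨.inr (.inr (.inr (.inr 3))), rfl⟩])

namespace TapeRule

open TapeLetter

variable {T Q Γ : Type*} [Inhabited Γ] (M : Q → Γ → Option (Q × TM0.Stmt Γ))
  (q₀ : Q) (c : T → List Γ) (F : List Γ)

/-- The left-hand sides. -/
def lhs : TapeRule T Q Γ → List (TapeLetter Q Γ)
  | emit _ => [generator]
  | start => [generator]
  | padLeft => [leftEnd]
  | padRight => [rightEnd]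
  | trans q a b =>
    match M q a with
    | some (_, .move .left) => [cell b, state q, cell a]
    | _ => [state q, cell a]
  | absorbLeft x => [x, halted]
  | absorbRight x => [halted, x]
  | vanish => [halted]

/-- The right-hand sides. -/
def rhs : TapeRule T Q Γ → List (TapeLetter Q Γ)
  | emit t => generator :: (c t).map cell
  | start => leftEnd :: state q₀ :: F.map cell
  | padLeft => [leftEnd, cell default]
  | padRight => [cell default, rightEnd]
  | trans q a b =>
    match M q a with
    | none => [halted]
    | some (q', .write a') => [state q', cell a']
    | some (q', .move .right) => [cell a, state q']
    | some (q', .move .left) => [state q', cell b, cell a]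
  | absorbLeft _ => [halted]
  | absorbRight _ => [halted]
  | vanish => []

/-- The output. -/
def out : TapeRule T Q Γ → List T
  | emit t => [t]
  | _ => []

/-- A configuration as a word: the tape `l ++ r`, with the head on the first cell of `r`. -/
abbrev config (q : Q) (l r : List Γ) : List (TapeLetter Q Γ) :=
  leftEnd :: (l.map cell ++ state q :: (r.map cell ++ [rightEnd]))

/-- The words with which a derivation starts. -/
abbrev inputForm (z : List Γ) : List (TapeLetter Q Γ) := generator :: (z.map cell ++ [rightEnd])

/-- The words from which the empty word can be reached. -/
abbrev Accepts : List (TapeLetter Q Γ) → List T → Prop :=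
  SemiThueAccepts (lhs M) (rhs M q₀ c F) out

variable {M q₀ c F}

lemma Accepts.of_eq {u : List (TapeLetter Q Γ)} {w w' : List T} (y x : List (TapeLetter Q Γ))
    (r : TapeRule T Q Γ) (h : Accepts M q₀ c F (y ++ rhs M q₀ c F r ++ x) w')
    (hu : u = y ++ lhs M r ++ x) (hw : w = out r ++ w') : Accepts M q₀ c F u w := by
  subst hu hw
  exact .step y r x h

lemma mk_append_default (l : List Γ) : ListBlank.mk (l ++ [default]) = ListBlank.mk l :=
  (Quotient.sound' (Or.inl ⟨1, rfl⟩)).symm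

/-- Only `generator` allows output, and no rule recreates it once it is gone. -/
lemma eq_nil_of_accepts {u : List (TapeLetter Q Γ)} {w : List T}
    (h : Accepts M q₀ c F u w) (hu : generator ∉ u) : w = [] := by
  induction h with
  | nil => rfl
  | step y r x h ih =>
    have key : generator ∉ lhs M r → out r = [] ∧ generator ∉ rhs M q₀ c F r := by
      intro hr
      rcases r with _ | _ | _ | _ | ⟨q, a, b⟩ | _ | _ | _
      · simp [lhs] at hr
      · simp [lhs] at hr
      · simp [out, rhs]
      · simp [out, rhs]
      · refine ⟨rfl, ?_⟩
        rcases hM : M q a with _ | ⟨q', (_ | _) | _⟩ <;> simp [rhs, hM]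
      · simp [out, rhs]
      · simp [out, rhs]
      · simp [out, rhs]
    simp only [List.mem_append, not_or] at hu ih
    obtain ⟨h₁, h₂⟩ := key hu.1.2
    simp [h₁, ih ⟨⟨hu.1.1, h₂⟩, hu.2⟩]

lemma accepts_of_halted (y x : List (TapeLetter Q Γ)) :
    Accepts M q₀ c F (y ++ halted :: x) [] := by
  induction x with
  | nil =>
    induction y using List.reverseRecOn with
    | nil => exact .of_eq [] [] vanish .nil rfl rfl
    | append_singleton y a ih =>
      exact .of_eq y [] (absorbLeft a) (by simpa [rhs] using ih) (by simp [lhs]) rfl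
  | cons a x ih =>
    exact .of_eq y x (absorbRight a) (by simpa [rhs] using ih) (by simp [lhs]) rfl

lemma accepts_inputForm (w : List T) (z : List Γ)
    (h : Accepts M q₀ c F (config q₀ [] (F ++ w.reverse.flatMap c ++ z)) []) :
    Accepts M q₀ c F (inputForm z) w := by
  induction w generalizing z with
  | nil => exact .of_eq [] (z.map cell ++ [rightEnd]) start (by simpa [rhs, config] using h) rfl rfl
  | cons t w ih =>
    refine .of_eq [] (z.map cell ++ [rightEnd]) (emit t) ?_ rfl rfl
    simpa [rhs, inputForm] using ih (c t ++ z) (by simpa using h)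

section Machine

variable {Λ : Type*} (ι : Q → Λ)

/-- The configuration that a word stands for. -/
def toCfg (q : Q) (l r : List Γ) : TM0.Cfg Γ Λ :=
  ⟨ι q, Tape.mk' (ListBlank.mk l.reverse) (ListBlank.mk r)⟩

lemma toCfg_padLeft (q : Q) (l r : List Γ) : toCfg ι q (default :: l) r = toCfg ι q l r := by
  simp [toCfg, mk_append_default]

lemma toCfg_padRight (q : Q) (l r : List Γ) : toCfg ι q l (r ++ [default]) = toCfg ι q l r := by
  simp [toCfg, mk_append_default]

variable [Inhabited Λ] {N : TM0.Machine Γ Λ} {ι} (hN : ∀ q a, N (ι q) a = (M q a).map fun p => (ι p.1, p.2))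
include hN

lemma step_none {q : Q} {a : Γ} (h : M q a = none) (l r : List Γ) :
    TM0.step N (toCfg ι q l (a :: r)) = none := by
  simp [TM0.step, toCfg, hN, h]

lemma step_write {q q' : Q} {a b : Γ} (h : M q a = some (q', .write b)) (l r : List Γ) :
    TM0.step N (toCfg ι q l (a :: r)) = some (toCfg ι q' l (b :: r)) := by
  simp [TM0.step, toCfg, hN, h]

lemma step_right {q q' : Q} {a : Γ} (h : M q a = some (q', .move .right)) (l r : List Γ) :
    TM0.step N (toCfg ι q l (a :: r)) = some (toCfg ι q' (l ++ [a]) r) := by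
  simp [TM0.step, toCfg, hN, h]

lemma step_left {q q' : Q} {a : Γ} (h : M q a = some (q', .move .left)) (l r : List Γ) (b : Γ) :
    TM0.step N (toCfg ι q (l ++ [b]) (a :: r)) = some (toCfg ι q' l (b :: a :: r)) := by
  simp [TM0.step, toCfg, hN, h]

/-- The unique state letter forces every transition to be the machine's own step, and padding only
adds blanks. Once `halted` appears the machine has halted, so nothing need be known about the
erasing phase. -/
lemma eval_dom_of_accepts {u : List (TapeLetter Q Γ)} {w : List T} (h : Accepts M q₀ c F u w) :
    ∀ q l r, u = config q l r → (eval (TM0.step N) (toCfg ι q l r)).Dom := by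
  induction h with
  | nil => intro q l r h; simp at h
  | step y R x h ih =>
    intro q l r hu
    rcases R with t | _ | _ | _ | ⟨q', a, b⟩ | z | z | _
    · have : generator ∈ config q l r := by rw [← hu]; simp [lhs]
      simp at this
    · have : generator ∈ config q l r := by rw [← hu]; simp [lhs]
      simp at this
    · simp only [lhs, List.append_assoc, List.singleton_append] at hu
      obtain ⟨rfl, -, rfl⟩ := (List.append_cons_inj_of_notMem (x₁ := []) (by simp)
        (by simp)).1 hu.symm
      rw [← toCfg_padLeft]
      exact ih q (default :: l) r (by simp [rhs])
    · simp only [lhs, List.append_assoc, List.singleton_append] at hu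
      obtain ⟨rfl, -, rfl⟩ := (List.append_cons_inj_of_notMem
        (x₁ := leftEnd :: (l.map cell ++ state q :: r.map cell)) (a₁ := rightEnd) (z₁ := []) (by simp)
        (by simp)).1 ((by simp : _ = config q l r).trans hu.symm)
      rw [← toCfg_padRight]
      exact ih q l (r ++ [default]) (by simp [rhs])
    · have key : ∀ y' x', config q l r = y' ++ state q' :: cell a :: x' →
          y' = leftEnd :: l.map cell ∧ q = q' ∧ ∃ r', r = a :: r' ∧
            x' = r'.map cell ++ [rightEnd] := by
        intro y' x' he
        obtain ⟨rfl, h₂, h₃⟩ := (List.append_cons_inj_of_notMem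
          (x₁ := leftEnd :: l.map cell) (by simp) (by simp)).1 he
        refine ⟨rfl, by simpa using h₂, ?_⟩
        cases r with
        | nil => simp at h₃
        | cons a' r' =>
          simp at h₃
          exact ⟨r', by simp [h₃.1], h₃.2.symm⟩
      rcases hM : M q' a with _ | ⟨q₁, (_ | _) | a'⟩ <;> simp only [lhs, hM] at hu
      · obtain ⟨rfl, rfl, r', rfl, rfl⟩ := key y x (by simpa using hu.symm)
        exact Part.dom_iff_mem.2 ⟨_, mem_eval.2 ⟨.refl, step_none hN hM _ _⟩⟩
      · obtain ⟨hy, rfl, r', rfl, rfl⟩ := key (y ++ [cell b]) x (by simpa using hu.symm)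
        obtain ⟨l', rfl, rfl⟩ : ∃ l', l = l' ++ [b] ∧ y = leftEnd :: l'.map cell := by
          rcases List.eq_nil_or_concat l with rfl | ⟨l', b', rfl⟩
          · simpa using congrArg List.getLast? hy
          · have : y ++ [cell b] = (leftEnd :: l'.map cell) ++ [cell b'] := by simpa using hy
            obtain ⟨rfl, h'⟩ := List.append_inj' this rfl
            exact ⟨l', by simpa using h'.symm, rfl⟩
        rw [reaches_eval (.single (step_left hN hM _ _ _))]
        exact ih _ _ _ (by simp [rhs, hM])
      · obtain ⟨rfl, rfl, r', rfl, rfl⟩ := key y x (by simpa using hu.symm)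
        rw [reaches_eval (.single (step_right hN hM _ _))]
        exact ih _ _ _ (by simp [rhs, hM])
      · obtain ⟨rfl, rfl, r', rfl, rfl⟩ := key y x (by simpa using hu.symm)
        rw [reaches_eval (.single (step_write hN hM _ _))]
        exact ih _ _ _ (by simp [rhs, hM])
    · have : halted ∈ config q l r := by rw [← hu]; simp [lhs]
      simp at this
    · have : halted ∈ config q l r := by rw [← hu]; simp [lhs]
      simp at this
    · have : halted ∈ config q l r := by rw [← hu]; simp [lhs]
      simp at this

lemma accepts_of_reaches {C D : TM0.Cfg Γ Λ} (h : Reaches (TM0.step N) C D)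
    (hD : TM0.step N D = none) :
    ∀ q l r, C = toCfg ι q l r → Accepts M q₀ c F (config q l r) [] := by
  -- Transitions need an explicit cell under the head; one blank provides it.
  have hpad : ∀ (q : Q) (l : List Γ), Accepts M q₀ c F (config q l [default]) [] →
      Accepts M q₀ c F (config q l []) [] := fun q l h =>
    .of_eq (leftEnd :: (l.map cell ++ [state q])) [] padRight (by simpa [rhs, config] using h)
      (by simp [lhs]) rfl
  induction h using Relation.ReflTransGen.head_induction_on with
  | refl =>
    intro q l r
    have main : ∀ a r, D = toCfg ι q l (a :: r) → Accepts M q₀ c F (config q l (a :: r)) [] := by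
      rintro a r rfl
      have hM : M q a = none := by
        rcases hM : M q a with _ | ⟨q₁, d⟩
        · rfl
        · simp [TM0.step, toCfg, hN, hM] at hD
      exact .of_eq (leftEnd :: l.map cell) (r.map cell ++ [rightEnd]) (trans q a a)
        (by simpa [rhs, hM] using
          accepts_of_halted (leftEnd :: l.map cell) (r.map cell ++ [rightEnd])) (by simp [lhs, hM]) rfl
    rintro rfl
    cases r with
    | nil => exact hpad q l (main _ _ (toCfg_padRight ι q l []).symm)
    | cons a r => exact main a r rfl
  | @head C C' hs _ ih =>
    intro q l r
    have main : ∀ a r, C = toCfg ι q l (a :: r) → Accepts M q₀ c F (config q l (a :: r)) [] := by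
      rintro a r rfl
      rcases hM : M q a with _ | ⟨q₁, (_ | _) | a'⟩
      · rw [step_none hN hM] at hs
        simp at hs
      · have left : ∀ l b, C' = toCfg ι q₁ l (b :: a :: r) →
            Accepts M q₀ c F (config q (l ++ [b]) (a :: r)) [] := fun l b h =>
          .of_eq (leftEnd :: l.map cell) (r.map cell ++ [rightEnd]) (trans q a b)
            (by simpa [rhs, hM, config] using ih _ _ _ h) (by simp [lhs, hM]) rfl
        rcases List.eq_nil_or_concat l with rfl | ⟨l', b, rfl⟩
        -- A left move at the left end first needs a blank to move onto.
        · rw [← toCfg_padLeft, ← List.nil_append [default], step_left hN hM] at hs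
          refine .of_eq [] (state q :: ((a :: r).map cell ++ [rightEnd])) padLeft ?_ rfl rfl
          simpa [rhs, config] using left [] default (Option.some.inj hs).symm
        · rw [List.concat_eq_append] at hs ⊢
          rw [step_left hN hM] at hs
          exact left l' b (Option.some.inj hs).symm
      · rw [step_right hN hM] at hs
        exact .of_eq (leftEnd :: l.map cell) (r.map cell ++ [rightEnd]) (trans q a a)
          (by simpa [rhs, hM, config] using ih _ _ _ (Option.some.inj hs).symm) (by simp [lhs, hM]) rfl
      · rw [step_write hN hM] at hs
        exact .of_eq (leftEnd :: l.map cell) (r.map cell ++ [rightEnd]) (trans q a a)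
          (by simpa [rhs, hM, config] using ih _ _ _ (Option.some.inj hs).symm) (by simp [lhs, hM]) rfl
    rintro rfl
    cases r with
    | nil => exact hpad q l (main _ _ (toCfg_padRight ι q l []).symm)
    | cons a r => exact main a r rfl

/-- Each emitted code is inserted directly after `generator`, before the earlier ones, whence the
reversal of `w`. -/
lemma eval_dom_of_accepts_inputForm {u : List (TapeLetter Q Γ)} {w : List T}
    (h : Accepts M q₀ c F u w) : ∀ z, u = inputForm z →
      (eval (TM0.step N) (toCfg ι q₀ [] (F ++ w.reverse.flatMap c ++ z))).Dom := by
  induction h with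
  | nil => intro z h; simp at h
  | @step y R x w h ih =>
    intro z hu
    have hgen : ∀ x', inputForm z = y ++ generator :: x' →
        y = [] ∧ x' = z.map cell ++ [rightEnd] := by
      intro x' he
      obtain ⟨rfl, -, rfl⟩ := (List.append_cons_inj_of_notMem (x₁ := []) (by simp)
        (by simp)).1 he
      exact ⟨rfl, rfl⟩
    rcases R with t | _ | _ | _ | ⟨q', a, b⟩ | e | e | _
    · obtain ⟨rfl, rfl⟩ := hgen x (by simpa [lhs] using hu.symm)
      simpa [out] using ih (c t ++ z) (by simp [rhs])
    · obtain ⟨rfl, rfl⟩ := hgen x (by simpa [lhs] using hu.symm)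
      have hw := eq_nil_of_accepts h (by simp [rhs])
      subst hw
      simpa [out] using eval_dom_of_accepts hN h q₀ [] (F ++ z) (by simp [rhs])
    · have : (leftEnd : TapeLetter Q Γ) ∈ inputForm z := by rw [← hu]; simp [lhs]
      simp at this
    · simp only [lhs, List.append_assoc, List.singleton_append] at hu
      obtain ⟨rfl, -, rfl⟩ := (List.append_cons_inj_of_notMem
        (x₁ := generator :: z.map cell) (a₁ := rightEnd) (z₁ := []) (by simp)
        (by simp)).1 ((by simp : _ = inputForm z).trans hu.symm)
      rw [← toCfg_padRight, List.append_assoc _ z]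
      exact ih (z ++ [default]) (by simp [rhs])
    · have : state q' ∈ inputForm z := by
        rw [← hu]
        rcases hM : M q' a with _ | ⟨q₁, (_ | _) | a'⟩ <;> simp [lhs, hM]
      simp at this
    · have : (halted : TapeLetter Q Γ) ∈ inputForm z := by rw [← hu]; simp [lhs]
      simp at this
    · have : (halted : TapeLetter Q Γ) ∈ inputForm z := by rw [← hu]; simp [lhs]
      simp at this
    · have : (halted : TapeLetter Q Γ) ∈ inputForm z := by rw [← hu]; simp [lhs]
      simp at this

theorem accepts_inputForm_iff (w : List T) : Accepts M q₀ c F (inputForm []) w ↔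
    (eval (TM0.step N) (toCfg ι q₀ [] (F ++ w.reverse.flatMap c))).Dom := by
  constructor
  · intro h
    simpa using eval_dom_of_accepts_inputForm hN h [] rfl
  · intro h
    obtain ⟨D, hD⟩ := Part.dom_iff_mem.1 h
    obtain ⟨h₁, h₂⟩ := mem_eval.1 hD
    exact accepts_inputForm w [] (by simpa using accepts_of_reaches hN h₁ h₂ _ _ _ rfl)

end Machine

end TapeRule

end TuringMachineRules

/-! ### Grammars from Turing machines and stack machines. -/

section MachineGrammars

open Turing StateTransition

variable {T : Type*} [Finite T]

theorem exists_scatteredContextGrammar_of_tm0 {Γ Λ : Type*} [Finite Γ] [Inhabited Γ] [Inhabited Λ]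
    (N : TM0.Machine Γ Λ) (S : Finset Λ) (hS : TM0.Supports N ↑S) (F : List Γ) (c : T → List Γ) :
    ∃ G : ScatteredContextGrammar T, Nat.card G.NT = 3 ∧ (∀ p ∈ G.productions, p.width ≤ 9) ∧
      ∀ w, w ∈ G.language ↔ (TM0.eval N (F ++ w.reverse.flatMap c)).Dom := by
  -- Restricting to the supporting set makes the set of states finite.
  have hex : ∀ (q : S) (a : Γ), ∃ o : Option (S × TM0.Stmt Γ),
      N q.1 a = o.map fun p => (p.1.1, p.2) := by
    intro q a
    rcases hN : N q.1 a with _ | ⟨q', s⟩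
    · exact ⟨none, rfl⟩
    · exact ⟨some (⟨q', hS.2 hN q.2⟩, s), rfl⟩
  choose M hM using hex
  obtain ⟨G, h₁, h₂, h₃⟩ := exists_scatteredContextGrammar_of_semiThue (T := T) (TapeRule.lhs M)
    (TapeRule.rhs M ⟨default, hS.1⟩ c F) TapeRule.out (TapeRule.inputForm [])
  refine ⟨G, h₁, h₂, fun w => (h₃ w).trans ?_⟩
  exact TapeRule.accepts_inputForm_iff (N := N) (ι := Subtype.val) hM w

theorem exists_scatteredContextGrammar_of_tm2 {K : Type*} [DecidableEq K] [Fintype K]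
    {Γ : K → Type*} [∀ k, Fintype (Γ k)] {Λ σ : Type*} [Inhabited Λ] [Inhabited σ] [Fintype σ]
    (M : Λ → TM2.Stmt Γ Λ σ) (S : Finset Λ) (hS : TM2.Supports M S) (k : K) (e : T → List (Γ k))
    (z : List (Γ k)) (hz : z ≠ []) :
    ∃ G : ScatteredContextGrammar T, Nat.card G.NT = 3 ∧ (∀ p ∈ G.productions, p.width ≤ 9) ∧
      ∀ w, w ∈ G.language ↔ (TM2.eval M k (w.flatMap e ++ z)).Dom := by
  let b : Γ k → TM2to1.Γ' K Γ := fun a => (false, Function.update (fun _ => none) k (some a))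
  -- Stacks are written bottom first with a mark on the bottom cell. As `z` is nonempty, the mark
  -- lies in the fixed part, and the input follows it letter by letter in reverse, as the generator
  -- produces it.
  have hinit : ∀ l, TM2to1.trInit k (l ++ z) = TM2to1.trInit k z ++ l.reverse.map b := by
    intro l
    obtain ⟨y, a, rfl⟩ := (List.eq_nil_or_concat z).resolve_left hz
    simp only [TM2to1.trInit, List.concat_eq_append, List.reverse_append, List.reverse_singleton,
      List.cons_append]
    exact congrArg (List.cons _) List.map_append
  obtain ⟨G, h₁, h₂, h₃⟩ := exists_scatteredContextGrammar_of_tm0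
    (TM1to0.tr (TM2to1.tr M)) _ (TM1to0.tr_supports _ (TM2to1.tr_supports M hS))
    (TM2to1.trInit k z) (fun t : T => (e t).reverse.map b)
  refine ⟨G, h₁, h₂, fun w => (h₃ w).trans ?_⟩
  rw [TM1to0.tr_eval, ← TM2to1.tr_eval_dom, hinit, List.reverse_flatMap, List.map_flatMap]
  rfl

end MachineGrammars

/-! ### Words coded as numbers, and recursively enumerable languages. -/

section NumberEncoding

open Turing PartrecToTM2 Encodable

variable {T : Type*} [Primcodable T]

/-- The number whose binary digits, beginning with the lowest, spell a word in a unary prefix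
code. -/
def wordNumber (w : List T) : ℕ :=
  w.foldr (fun t n => (fun m => 2 * m + 1)^[encode t] (2 * n)) 1

/-- The binary digits of a letter. -/
def letterDigits (t : T) : List Γ' := List.replicate (encode t) Γ'.bit1 ++ [Γ'.bit0]

lemma primrec_wordNumber : Primrec (wordNumber (T := T)) := by
  have h : Primrec₂ fun (_ : List T) (p : T × ℕ) =>
      (fun m => 2 * m + 1)^[encode p.1] (2 * p.2) :=
    Primrec.nat_iterate (Primrec.encode.comp (Primrec.fst.comp Primrec.snd))
      (Primrec.nat_double.comp (Primrec.snd.comp Primrec.snd))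
      (Primrec.nat_double_succ.comp₂ Primrec₂.right)
  exact Primrec.list_foldr Primrec.id (Primrec.const 1) h

lemma trNat_two_mul {n : ℕ} (hn : n ≠ 0) : trNat (2 * n) = Γ'.bit0 :: trNat n := by
  have h : ((2 * n : ℕ) : Num) = (n : Num).bit0 := by
    rw [← Num.bit0_of_bit0, two_mul, Nat.cast_add]
  have hn' : (n : Num) ≠ 0 := by exact_mod_cast hn
  rw [trNat, trNat, h]
  cases hm : (n : Num) with
  | zero => exact (hn' hm).elim
  | pos p => rfl

lemma trNat_two_mul_add_one (n : ℕ) : trNat (2 * n + 1) = Γ'.bit1 :: trNat n := by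
  have h : ((2 * n + 1 : ℕ) : Num) = (n : Num).bit1 := by
    rw [← Num.bit1_of_bit1, two_mul, Nat.cast_add, Nat.cast_add, Nat.cast_one]
  rw [trNat, trNat, h]
  cases (n : Num) <;> rfl

lemma trNat_iterate (k n : ℕ) :
    trNat ((fun m => 2 * m + 1)^[k] n) = List.replicate k Γ'.bit1 ++ trNat n := by
  induction k with
  | zero => rfl
  | succ k ih => rw [Function.iterate_succ_apply', trNat_two_mul_add_one, ih,
      List.replicate_succ, List.cons_append]

lemma iterate_ne_zero {k n : ℕ} (hn : n ≠ 0) : (fun m => 2 * m + 1)^[k] n ≠ 0 := by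
  cases k with
  | zero => exact hn
  | succ k => rw [Function.iterate_succ_apply']; omega

lemma wordNumber_ne_zero (w : List T) : wordNumber w ≠ 0 := by
  induction w with
  | nil => simp [wordNumber]
  | cons t w ih => exact iterate_ne_zero (mul_ne_zero two_ne_zero ih)

/-- This is why the code is chosen: the machine's input is a letterwise image of `w` followed by a
fixed tail, which a generator without memory can write. The tail is the leading digit, without which
a high 0 would be lost. -/
lemma trNat_wordNumber (w : List T) :
    trNat (wordNumber w) = w.flatMap letterDigits ++ [Γ'.bit1] := by
  induction w with
  | nil =>
    change trNat (2 * 0 + 1) = _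
    rw [trNat_two_mul_add_one, trNat_zero]
    rfl
  | cons t w ih =>
    change trNat ((fun m => 2 * m + 1)^[encode t] (2 * wordNumber w)) = _
    rw [trNat_iterate, trNat_two_mul (wordNumber_ne_zero w), ih]
    simp [letterDigits]

lemma wordNumber_injective : Function.Injective (wordNumber (T := T)) := by
  intro v w h
  have h' := congrArg trNat h
  rw [trNat_wordNumber, trNat_wordNumber] at h'
  refine flatMap_unaryCode_injective (β := T) encode_injective ?_
  have := congrArg (List.map fun x => decide (x = Γ'.bit1)) (List.append_cancel_right h')
  simpa [List.map_flatMap, letterDigits, unaryCode] using this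

/-- The code is inverted by unbounded search, and the semidecision procedure is then run on the word
found. -/
lemma exists_partrec_wordNumber {L : Language T} (hL : REPred fun w : List T => w ∈ L) :
    ∃ f : ℕ →. ℕ, Partrec f ∧ ∀ w, (f (wordNumber w)).Dom ↔ w ∈ L := by
  let s : ℕ → ℕ → Option (List T) := fun n m =>
    (decode m : Option (List T)).bind fun w => if wordNumber w = n then some w else none
  have hs : Computable₂ s := by
    have hite : Primrec₂ fun (p : ℕ × ℕ) (w : List T) =>
        if wordNumber w = p.1 then some w else none := by
      refine Primrec.ite ?_ (Primrec.option_some.comp Primrec.snd) (Primrec.const none)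
      exact Primrec.eq.comp (primrec_wordNumber.comp Primrec.snd) (Primrec.fst.comp Primrec.fst)
    exact Primrec.to_comp (Primrec.option_bind (Primrec.decode.comp Primrec.snd) hite)
  have hmem : ∀ w w', w' ∈ Nat.rfindOpt (s (wordNumber w)) → w' = w := by
    intro w w' h
    obtain ⟨m, hm⟩ := Nat.rfindOpt_spec h
    simp only [s, Option.mem_def, Option.bind_eq_some_iff] at hm
    obtain ⟨v, -, hv⟩ := hm
    split_ifs at hv with h'
    simp only [Option.some.injEq] at hv
    exact hv ▸ wordNumber_injective h'
  have hdom : ∀ w, w ∈ Nat.rfindOpt (s (wordNumber w)) := by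
    intro w
    obtain ⟨w', hw'⟩ := Part.dom_iff_mem.1 (Nat.rfindOpt_dom.2
      ⟨encode w, w, by simp [s]⟩ : (Nat.rfindOpt (s (wordNumber w))).Dom)
    exact hmem w w' hw' ▸ hw'
  refine ⟨fun n => (Nat.rfindOpt (s n)).bind fun w =>
    (Part.assert (w ∈ L) fun _ => Part.some ()).map fun _ => 0, ?_, fun w => ?_⟩
  · exact (Partrec.rfindOpt hs).bind
      (((show Partrec _ from hL).comp Computable.snd).map (Computable.const 0).to₂).to₂
  · beta_reduce
    rw [Part.eq_some_iff.2 (hdom w), Part.bind_some]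
    simp [Part.assert]

instance : Fintype K' := ⟨{.main, .rev, .aux, .stack}, by rintro (_ | _ | _ | _) <;> simp⟩

theorem exists_scatteredContextGrammar_of_rePred [Finite T] {L : Language T}
    (hL : REPred fun w : List T => w ∈ L) :
    ∃ G : ScatteredContextGrammar T, Nat.card G.NT = 3 ∧ (∀ p ∈ G.productions, p.width ≤ 9) ∧
      ∀ w, w ∈ G.language ↔ w ∈ L := by
  obtain ⟨f, hf, hfL⟩ := exists_partrec_wordNumber hL
  obtain ⟨c, hc⟩ := ToPartrec.Code.exists_code (Nat.Partrec'.part_iff₁.2 hf)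
  -- The default label is the one at which the machine starts; it has to be the entry point of `c`.
  let : Inhabited Λ' := ⟨trNormal c Cont'.halt⟩
  obtain ⟨G, h₁, h₂, h₃⟩ := exists_scatteredContextGrammar_of_tm2 tr _
    (tr_supports c Cont'.halt) K'.main (letterDigits (T := T)) [Γ'.bit1, Γ'.cons] (by simp)
  refine ⟨G, h₁, h₂, fun w => (h₃ w).trans ?_⟩
  have hl : w.flatMap letterDigits ++ [Γ'.bit1, Γ'.cons] = trList [wordNumber w] := by
    simp [trNat_wordNumber]
  have hinit : TM2.init K'.main (trList [wordNumber w]) = init c [wordNumber w] := by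
    simp only [TM2.init, init]
    congr 1
    funext k
    cases k <;> rfl
  rw [hl, ← hfL w]
  change (StateTransition.eval (TM2.step tr) (TM2.init K'.main (trList [wordNumber w]))).Dom ↔ _
  rw [hinit, tr_eval, show c.eval [wordNumber w] = _ from hc ⟨[wordNumber w], rfl⟩]
  rfl

end NumberEncoding

theorem mainTheorem1 {T : Type*} [Finite T] [Primcodable T] (L : Language T)
    (hL : REPred (fun w : List T => w ∈ L)) :
    ∃ G : ScatteredContextGrammar T,
      Nat.card G.NT = 3 ∧
      (∀ p ∈ G.productions, p.width ≤ 9) ∧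
      G.language = L := by
  obtain ⟨G, h₁, h₂, h₃⟩ := exists_scatteredContextGrammar_of_rePred hL
  exact ⟨G, h₁, h₂, Set.ext h₃⟩
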